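/- Let $\mathcal P^{24}\subset \mathrm{SO}(3)$ denote the set of the 24 rotations mapping the cube $[-1,1]^3$ onto itself. For a compact set $L\subset\mathbb R^{3\times 3}$ and a bounded domain (nonempty, open, connected set) $\Omega\subset\mathbb R^3$, the quasiconvex hull $L^{qc}$ is the set of all matrices $F\in\mathbb R^{3\times 3}$ for which there is a sequence $z^{i}$, uniformly bounded in $W^{1,\infty}(\Omega,\mathbb R^3)$, converging weakly$*$ in $W^{1,\infty}(\Omega,\mathbb R^3)$ to the linear map $x\mapsto Fx$, and such that $Dz^{i}\to L$ in measure, i.e. $\mathrm{meas}\{x\in\Omega: Dz^{i}(x)\notin V\}\to 0$ as $i\to\infty$ for every open set $V\supseteq L$. Lemma. Let $U\in\mathbb R^{3\times3}$ be symmetric and positive definite with $\det U=\Delta$, and let $$K:=\bigcup_{R\in\mathcal P^{24}}\mathrm{SO}(3)\,R^TUR .$$ Let $j,k\in\{1,2,3\}$ with $j\neq k$, and let $(\mu,\nu,\xi)$ be any permutation of the triple $$\left(\frac{\Delta}{\sqrt{(\mathrm{cof}\,U^2)_{jj}}},\ \sqrt{\frac{(\mathrm{cof}\,U^2)_{jj}}{(U^2)_{kk}}},\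 \sqrt{(U^2)_{kk}}\right),$$ where $\mathrm{cof}\,A$ denotes the cofactor matrix of $A$. Then, for every bounded domain $\Omega\subset\mathbb R^3$ used in the definition of the hull, $K^{qc}$ contains the three-well configuration $$K_{ct}=\bigcup_{i=1}^{3}\mathrm{SO}(3)V_i,$$ where $$V_1=\mathrm{diag}(\mu,\sqrt{\nu\xi},\sqrt{\nu\xi}),\quad V_2=\mathrm{diag}(\sqrt{\nu\xi},\mu,\sqrt{\nu\xi}),\quad V_3=\mathrm{diag}(\sqrt{\nu\xi},\sqrt{\nu\xi},\mu).$$ -/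

import Mathlib

open MeasureTheory Filter Topology
open scoped Matrix ContDiff

namespace CubicAustenite

/-- Three-dimensional Euclidean space, carrying the reference configuration and the deformations. -/
abbrev E3 : Type := EuclideanSpace ℝ (Fin 3)

/-- Real `3 × 3` matrices. -/
abbrev Mat3 : Type := Matrix (Fin 3) (Fin 3) ℝ

/-- The rotation group `SO(3)`. -/
def SO3 : Set Mat3 := {Q | Qᵀ * Q = 1 ∧ Q.det = 1}

/-- A domain is an open, connected (and nonempty) set; here it is also bounded. -/
structure IsBoundedDomain (Ω : Set E3) : Prop where
  isOpen : IsOpen Ω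
  isConnected : IsConnected Ω
  isBounded : Bornology.IsBounded Ω

/-- `z ∈ W^{1,∞}(Ω, ℝ³)` with weak gradient `Dz = G`, that is `∂ₖ zᵢ = G i k` in the sense of
distributions on `Ω`, and all `zᵢ`, `G i k` belong to `L^∞(Ω)`. -/
structure IsW1InftyMap (Ω : Set E3) (z : E3 → E3) (G : E3 → Mat3) : Prop where
  memLp_map : ∀ i, MemLp (fun x => z x i) ⊤ (volume.restrict Ω)
  memLp_grad : ∀ i k, MemLp (fun x => G x i k) ⊤ (volume.restrict Ω)
  weak_grad : ∀ φ : E3 → ℝ, ContDiff ℝ ∞ φ → HasCompactSupport φ → tsupport φ ⊆ Ω →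
    ∀ i k, ∫ x in Ω, z x i * fderiv ℝ φ x (EuclideanSpace.single k 1)
      = - ∫ x in Ω, G x i k * φ x

/-- The sequence `z j`, with gradients `G j`, is uniformly bounded in `W^{1,∞}(Ω, ℝ³)`. -/
def UniformlyBoundedW1Infty (Ω : Set E3) (z : ℕ → E3 → E3) (G : ℕ → E3 → Mat3) : Prop :=
  ∃ M : ℝ, ∀ j, ∀ᵐ x ∂(volume.restrict Ω), (∀ i, |z j x i| ≤ M) ∧ ∀ i k, |G j x i k| ≤ M

/-- Weak* convergence `f j ⇀* g` in `L^∞(Ω)`, the dual of `L¹(Ω)`. -/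
def WeakStarTendsto (Ω : Set E3) (f : ℕ → E3 → ℝ) (g : E3 → ℝ) : Prop :=
  ∀ h : E3 → ℝ, Integrable h (volume.restrict Ω) →
    Tendsto (fun j => ∫ x in Ω, f j x * h x) atTop (𝓝 (∫ x in Ω, g x * h x))

/-- `G j → L` in measure on `Ω`: for every open neighbourhood `V` of `L`, the measure of the set
where `G j x ∉ V` tends to zero. -/
def TendstoSetInMeasure (Ω : Set E3) (G : ℕ → E3 → Mat3) (L : Set Mat3) : Prop :=
  ∀ V : Set Mat3, IsOpen V → L ⊆ V →
    Tendsto (fun j => volume {x | x ∈ Ω ∧ G j x ∉ V}) atTop (𝓝 0)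

/-- The quasiconvex hull `L^qc` of a compact set `L` of matrices: all `F` for which there is a
sequence `z j`, uniformly bounded in `W^{1,∞}(Ω, ℝ³)`, converging weakly* in `W^{1,∞}(Ω, ℝ³)` to
the linear map `x ↦ F x`, and with `D(z j) → L` in measure. -/
def quasiconvexHull (Ω : Set E3) (L : Set Mat3) : Set Mat3 :=
  {F | ∃ (z : ℕ → E3 → E3) (G : ℕ → E3 → Mat3),
    (∀ j, IsW1InftyMap Ω (z j) (G j)) ∧
    UniformlyBoundedW1Infty Ω z G ∧
    (∀ i, WeakStarTendsto Ω (fun j x => z j x i) (fun x => (F *ᵥ x.ofLp) i)) ∧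
    (∀ i k, WeakStarTendsto Ω (fun j x => G j x i k) (fun _ => F i k)) ∧
    TendstoSetInMeasure Ω G L}

/-- The cube `[-1, 1]³`. -/
def cube : Set (Fin 3 → ℝ) := {x | ∀ i, |x i| ≤ 1}

/-- The group `P²⁴` of rotations mapping the cube onto itself. -/
def P24 : Set Mat3 := {R | R ∈ SO3 ∧ (fun x => R *ᵥ x) '' cube = cube}

/-- The cofactor matrix. -/
def cof (A : Mat3) : Mat3 := A.adjugateᵀ

/-- The set of martensitic wells `K = ⋃_{R ∈ P²⁴} SO(3) Rᵀ U R`. -/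
def wells (U : Mat3) : Set Mat3 :=
  {F | ∃ R ∈ P24, ∃ Q ∈ SO3, F = Q * (Rᵀ * U * R)}

/-- The three-well configuration
`SO(3) diag(μ, s, s) ∪ SO(3) diag(s, μ, s) ∪ SO(3) diag(s, s, μ)`. -/
def threeWells (μ s : ℝ) : Set Mat3 :=
  {F | ∃ Q ∈ SO3, F = Q * Matrix.diagonal ![μ, s, s] ∨ F = Q * Matrix.diagonal ![s, μ, s] ∨
    F = Q * Matrix.diagonal ![s, s, μ]}

/-- The three numbers `Δ / √(cof U²)ⱼⱼ`, `√((cof U²)ⱼⱼ / (U²)ₖₖ)`, `√(U²)ₖₖ`. -/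
noncomputable def stretches (U : Mat3) (Δ : ℝ) (j k : Fin 3) : Fin 3 → ℝ :=
  ![Δ / √(cof (U ^ 2) j j), √(cof (U ^ 2) j j / (U ^ 2) k k), √((U ^ 2) k k)]

end CubicAustenite

/-! The wells are reached by finitely many rank-one laminations, and the hull absorbs such
laminations. For the latter, the induction runs on `approxHull`, whose approximations are globally
defined, uniformly Lipschitz and uniformly close to the linear map. If A - B = a ⊗ n, maps
approximating A and B are blended with a fine periodic phase function of n · x
(`approxHull_laminate`). An `approxHull` sequence yields the weak* limits by integration by parts
(`mem_quasiconvexHull_of_mem_approxHull`).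

The algebra takes place on Cauchy–Green tensors C = FᵀF, since the hull is invariant under left
rotations. A half-turn about v in the cubic group makes F and a rotated copy of F twins, rank-one
connected with normal v. Their laminates keep C on the plane orthogonal to v, keep det C, and
multiply the shears between v and that plane by any t in [-1, 1] (`exists_twin_laminate`).

With t = 0 along two coordinate axes, U² becomes diagonal with the square roots of its entries equal
to the three given stretches (`exists_perm_diagonal_stretches_mem`). Two further laminations along
face diagonals turn diag(μ, ν, ξ) into diag(μ, √(νξ), √(νξ)) (`diagonal_sqrt_mem`). Cubic symmetry
permutes the axes and gives the other two wells. -/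

namespace CubicAustenite

/-! ### One-dimensional periodic phase functions. -/

section Profile

/-- A smooth function of period one, positive exactly on `(0, l)` modulo one. -/
noncomputable def phase (l s : ℝ) : ℝ := Real.sin (Real.pi * s) * Real.sin (Real.pi * (l - s))

lemma phase_periodic (l : ℝ) : Function.Periodic (phase l) 1 := by
  intro s
  have h1 : Real.pi * (s + 1) = Real.pi * s + Real.pi := by ring
  have h2 : Real.pi * (l - (s + 1)) = Real.pi * (l - s) - Real.pi := by ring
  simp only [phase]
  rw [h1, h2, Real.sin_add_pi, Real.sin_sub_pi]
  ring

lemma phase_contDiff (l : ℝ) : ContDiff ℝ 1 (phase l) := by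
  unfold phase
  fun_prop

lemma phase_nonneg {l s : ℝ} (hl : l ≤ 1) (h0 : 0 ≤ s) (h1 : s ≤ l) : 0 ≤ phase l s := by
  have hp := Real.pi_pos
  refine mul_nonneg (Real.sin_nonneg_of_nonneg_of_le_pi ?_ ?_)
    (Real.sin_nonneg_of_nonneg_of_le_pi ?_ ?_) <;> nlinarith

lemma phase_nonpos {l s : ℝ} (hl : 0 ≤ l) (h0 : l ≤ s) (h1 : s ≤ 1) : phase l s ≤ 0 := by
  have hp := Real.pi_pos
  refine mul_nonpos_of_nonneg_of_nonpos (Real.sin_nonneg_of_nonneg_of_le_pi ?_ ?_)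
    (Real.sin_nonpos_of_nonpos_of_neg_pi_le ?_ ?_) <;> nlinarith

lemma countable_phase_eq_zero (l : ℝ) {N : ℝ} (hN : N ≠ 0) :
    {s : ℝ | phase l (N * s) = 0}.Countable := by
  have hc : {u : ℝ | Real.sin u = 0}.Countable := by
    refine (Set.countable_range fun n : ℤ => (n : ℝ) * Real.pi).mono ?_
    intro u hu
    obtain ⟨n, hn⟩ := Real.sin_eq_zero_iff.1 hu
    exact ⟨n, hn⟩
  have hp := Real.pi_ne_zero
  have h1 : Function.Injective fun s : ℝ => Real.pi * (N * s) := fun s t h => by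
    simpa [hp, hN] using h
  have h2 : Function.Injective fun s : ℝ => Real.pi * (l - N * s) := fun s t h => by
    simpa [hp, hN] using h
  refine ((hc.preimage h1).union (hc.preimage h2)).mono ?_
  intro s hs
  simpa [phase] using hs

/-- A `C¹` periodic function with values in `[0, 1]` and prescribed mean, which takes only the
values `0` and `1` away from the zeros of `phase l`. -/
lemma exists_periodic_transition {l : ℝ} (hl0 : 0 ≤ l) (hl1 : l ≤ 1) {δ : ℝ} (hδ : 0 < δ) :
    ∃ α : ℝ → ℝ, ContDiff ℝ 1 α ∧ Function.Periodic α 1 ∧ (∀ s, 0 ≤ α s) ∧ (∀ s, α s ≤ 1) ∧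
      ∫ s in (0 : ℝ)..1, α s = l ∧ ∀ s, δ ≤ |phase l s| → α s = 0 ∨ α s = 1 := by
  -- `θ₁` vanishes where the phase is nonpositive and `θ₂` equals one where it is nonnegative, so
  -- their means bracket `l` and some convex combination has mean exactly `l`. The two agree, with
  -- value 0 or 1, wherever the phase is at least `δ` in modulus.
  set θ₁ : ℝ → ℝ := fun s => Real.smoothTransition (phase l s / δ) with hθ₁
  set θ₂ : ℝ → ℝ := fun s => Real.smoothTransition (phase l s / δ + 1) with hθ₂
  have hT : ContDiff ℝ 1 Real.smoothTransition := Real.smoothTransition.contDiff (n := 1)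
  have hc₁ : ContDiff ℝ 1 θ₁ := hT.comp ((phase_contDiff l).div_const δ)
  have hc₂ : ContDiff ℝ 1 θ₂ := hT.comp (((phase_contDiff l).div_const δ).add contDiff_const)
  have hi₁ : ∀ a b, IntervalIntegrable θ₁ volume a b := fun a b =>
    hc₁.continuous.intervalIntegrable a b
  have hi₂ : ∀ a b, IntervalIntegrable θ₂ volume a b := fun a b =>
    hc₂.continuous.intervalIntegrable a b
  have hm₁ : ∫ s in (0 : ℝ)..1, θ₁ s ≤ l := by
    rw [← intervalIntegral.integral_add_adjacent_intervals (hi₁ 0 l) (hi₁ l 1)]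
    have h1 : ∫ s in (0 : ℝ)..l, θ₁ s ≤ ∫ s in (0 : ℝ)..l, (1 : ℝ) :=
      intervalIntegral.integral_mono_on hl0 (hi₁ 0 l) (by simp)
        fun s _ => Real.smoothTransition.le_one _
    have h2 : ∫ s in l..1, θ₁ s ≤ ∫ s in l..1, (0 : ℝ) :=
      intervalIntegral.integral_mono_on hl1 (hi₁ l 1) (by simp) fun s hs =>
        (Real.smoothTransition.zero_of_nonpos
          (div_nonpos_of_nonpos_of_nonneg (phase_nonpos hl0 hs.1 hs.2) hδ.le)).le
    simp at h1 h2
    linarith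
  have hm₂ : l ≤ ∫ s in (0 : ℝ)..1, θ₂ s := by
    rw [← intervalIntegral.integral_add_adjacent_intervals (hi₂ 0 l) (hi₂ l 1)]
    have h1 : ∫ s in (0 : ℝ)..l, (1 : ℝ) ≤ ∫ s in (0 : ℝ)..l, θ₂ s :=
      intervalIntegral.integral_mono_on hl0 (by simp) (hi₂ 0 l) fun s hs =>
        (Real.smoothTransition.one_of_one_le
          (le_add_of_nonneg_left (div_nonneg (phase_nonneg hl1 hs.1 hs.2) hδ.le))).ge
    have h2 : ∫ s in l..1, (0 : ℝ) ≤ ∫ s in l..1, θ₂ s :=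
      intervalIntegral.integral_mono_on hl1 (by simp) (hi₂ l 1) fun s hs =>
        Real.smoothTransition.nonneg _
    simp at h1 h2
    linarith
  obtain ⟨a, b, ha, hb, hab, hmean⟩ : l ∈ segment ℝ (∫ s in (0 : ℝ)..1, θ₁ s)
      (∫ s in (0 : ℝ)..1, θ₂ s) := by
    rw [segment_eq_Icc (hm₁.trans hm₂)]
    exact ⟨hm₁, hm₂⟩
  refine ⟨fun s => a * θ₁ s + b * θ₂ s, by fun_prop, ?_, ?_, ?_, ?_, ?_⟩
  · intro s
    simp only [hθ₁, hθ₂, phase_periodic l s]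
  · intro s
    exact add_nonneg (mul_nonneg ha (Real.smoothTransition.nonneg _))
      (mul_nonneg hb (Real.smoothTransition.nonneg _))
  · intro s
    have h1 : θ₁ s ≤ 1 := Real.smoothTransition.le_one _
    have h2 : θ₂ s ≤ 1 := Real.smoothTransition.le_one _
    nlinarith
  · rw [intervalIntegral.integral_add ((hi₁ 0 1).const_mul a) ((hi₂ 0 1).const_mul b),
      intervalIntegral.integral_const_mul, intervalIntegral.integral_const_mul]
    exact hmean
  · intro s hs
    rcases le_abs.1 hs with h | h
    · right
      have hd : 1 ≤ phase l s / δ := (one_le_div hδ).2 h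
      have h1 : θ₁ s = 1 := Real.smoothTransition.one_of_one_le hd
      have h2 : θ₂ s = 1 := Real.smoothTransition.one_of_one_le (by linarith)
      simp [h1, h2, hab]
    · left
      have hd : phase l s / δ ≤ -1 := by
        rw [div_le_iff₀ hδ]; linarith
      have h1 : θ₁ s = 0 := Real.smoothTransition.zero_of_nonpos (by linarith)
      have h2 : θ₂ s = 0 := Real.smoothTransition.zero_of_nonpos (by linarith)
      simp [h1, h2]

/-- The phase function `α` of a fine simple laminate with volume fraction `l`, together with the
small oscillation `h` whose slope is `α - l`. -/
lemma exists_laminate_profile (τ : Measure ℝ) [IsFiniteMeasure τ] [NullSingletonClass τ]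
    {l : ℝ} (hl0 : 0 ≤ l) (hl1 : l ≤ 1) {ε : ℝ} (hε : 0 < ε) :
    ∃ α h : ℝ → ℝ, ContDiff ℝ 1 α ∧ ContDiff ℝ 1 h ∧ (∀ s, HasDerivAt h (α s - l) s) ∧
      (∀ s, |h s| ≤ ε) ∧ (∀ s, 0 ≤ α s) ∧ (∀ s, α s ≤ 1) ∧ (∃ C, ∀ s, |deriv α s| ≤ C) ∧
      τ {s | ¬ (α s = 0 ∨ α s = 1)} ≤ ENNReal.ofReal ε := by
  obtain ⟨N, hN⟩ : ∃ N : ℝ, N = 1 / ε := ⟨_, rfl⟩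
  have hN0 : 0 < N := hN ▸ by positivity
  obtain ⟨δ, hδ, hτ⟩ : ∃ δ : ℝ, 0 < δ ∧
      τ {s | |phase l (N * s)| < δ} ≤ ENNReal.ofReal ε := by
    set S : ℕ → Set ℝ := fun n => {s | |phase l (N * s)| < 1 / ((n : ℝ) + 1)} with hS
    have hcont : Continuous fun s => |phase l (N * s)| := by
      have := (phase_contDiff l).continuous
      fun_prop
    -- Continuity from above: the transition layers shrink to the countable zero set of the phase,
    -- which is null because `τ` has no atoms.
    have hlim : Tendsto (fun n => τ (S n)) atTop (𝓝 (τ (⋂ n, S n))) := by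
      refine tendsto_measure_iInter_atTop
        (fun n => (isOpen_lt hcont continuous_const).measurableSet.nullMeasurableSet) ?_
        ⟨0, measure_ne_top _ _⟩
      intro m n hmn s hs
      have hle : 1 / ((n : ℝ) + 1) ≤ 1 / ((m : ℝ) + 1) := by gcongr
      exact lt_of_lt_of_le (show |phase l (N * s)| < _ from hs) hle
    have hzero : τ (⋂ n, S n) = 0 := by
      refine measure_mono_null ?_ ((countable_phase_eq_zero l hN0.ne').measure_zero τ)
      intro s hs
      rw [Set.mem_iInter] at hs
      by_contra hne
      obtain ⟨n, hn⟩ := exists_nat_one_div_lt (abs_pos.2 hne)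
      exact absurd (hs n) (not_lt.2 hn.le)
    rw [hzero] at hlim
    obtain ⟨n, hn⟩ := (hlim.eventually_le_const (ENNReal.ofReal_pos.2 hε)).exists
    exact ⟨1 / ((n : ℝ) + 1), by positivity, hn⟩
  obtain ⟨α, hα, hper, h0, h1, hmean, hval⟩ := exists_periodic_transition hl0 hl1 hδ
  have hαc : Continuous α := hα.continuous
  set H : ℝ → ℝ := fun s => ∫ t in (0 : ℝ)..s, (α t - l) with hHdef
  have hint : ∀ a b, IntervalIntegrable (fun t => α t - l) volume a b := fun a b =>
    (hαc.sub continuous_const).intervalIntegrable a b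
  have hH : ∀ s, HasDerivAt H (α s - l) s := fun s =>
    intervalIntegral.integral_hasDerivAt_right (hint 0 s)
      ((hαc.sub continuous_const).stronglyMeasurableAtFilter _ _)
      (hαc.sub continuous_const).continuousAt
  -- `α - l` has mean zero over a period, so its primitive is periodic, hence bounded. Rescaling by
  -- `N = 1 / ε` then makes the oscillation at most `ε` without changing the slopes.
  have hHper : Function.Periodic H 1 := by
    intro s
    have hp : Function.Periodic (fun t => α t - l) 1 := fun t => by simp only [hper t]
    have := hp.intervalIntegral_add_eq s 0
    simp only [hHdef]
    rw [← intervalIntegral.integral_add_adjacent_intervals (hint 0 s) (hint s (s + 1)), this,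
      zero_add, intervalIntegral.integral_sub (hαc.intervalIntegrable 0 1) (by simp), hmean]
    simp
  have hHb : ∀ s, |H s| ≤ 1 := by
    intro s
    obtain ⟨y, hy, hye⟩ := hHper.exists_mem_Ico₀ one_pos s
    rw [hye]
    have := intervalIntegral.norm_integral_le_of_norm_le_const (a := 0) (b := y) (C := 1)
      (f := fun t => α t - l) fun t _ => by
        rw [Real.norm_eq_abs, abs_le]
        constructor <;> linarith [h0 t, h1 t]
    simp only [Real.norm_eq_abs, sub_zero, one_mul, abs_of_nonneg hy.1] at this
    exact this.trans hy.2.le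
  have hscale : ∀ s, HasDerivAt (fun s : ℝ => N * s) N s := fun s => by
    simpa using (hasDerivAt_id s).const_mul N
  refine ⟨fun s => α (N * s), fun s => H (N * s) / N, by fun_prop, ?_, ?_, ?_, fun s => h0 _,
    fun s => h1 _, ?_, ?_⟩
  · have hH1 : ContDiff ℝ 1 H := by
      rw [contDiff_one_iff_deriv]
      refine ⟨fun s => (hH s).differentiableAt, ?_⟩
      rw [funext fun s => (hH s).deriv]
      exact hαc.sub continuous_const
    fun_prop
  · intro s
    have := ((hH (N * s)).comp s (hscale s)).div_const N
    simpa [hN0.ne'] using this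
  · intro s
    rw [abs_div, abs_of_pos hN0, div_le_iff₀ hN0, hN, mul_one_div_cancel hε.ne', ← hN]
    exact hHb _
  · have hdper : Function.Periodic (deriv α) 1 := by
      intro s
      rw [← deriv_comp_add_const]
      congr 1
      exact funext hper
    obtain ⟨C, hC⟩ := (hdper.isBounded_of_continuous one_ne_zero
      (hα.continuous_deriv le_rfl)).exists_norm_le
    refine ⟨C * N, fun s => ?_⟩
    have hd := ((hα.differentiable one_ne_zero (N * s)).hasDerivAt.comp s (hscale s)).deriv
    simp only [Function.comp_def] at hd
    rw [hd, abs_mul, abs_of_pos hN0]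
    exact mul_le_mul_of_nonneg_right (hC _ ⟨_, rfl⟩) hN0.le
  · refine (measure_mono ?_).trans hτ
    intro s hs
    by_contra hlt
    exact hs (hval _ (not_lt.1 hlt))

end Profile

end CubicAustenite

namespace CubicAustenite

/-! ### Approximation of linear maps by laminates. -/

section Lamination

open scoped RealInnerProductSpace

/-- Linear maps which can be approximated, uniformly on the whole space, by uniformly Lipschitz
`C¹` maps whose derivative belongs to `S` on `Ω` up to a set of small measure. -/
def approxHull (Ω : Set E3) (S : Set (E3 →L[ℝ] E3)) : Set (E3 →L[ℝ] E3) :=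
  {F | ∃ M : ℝ, ∀ ε : ℝ, 0 < ε → ∃ f : E3 → E3, ContDiff ℝ 1 f ∧ (∀ x, ‖fderiv ℝ f x‖ ≤ M) ∧
    (∀ x, ‖f x - F x‖ ≤ ε) ∧ volume {x | x ∈ Ω ∧ fderiv ℝ f x ∉ S} ≤ ENNReal.ofReal ε}

lemma subset_approxHull (Ω : Set E3) (S : Set (E3 →L[ℝ] E3)) : S ⊆ approxHull Ω S := by
  intro F hF
  refine ⟨‖F‖, fun ε hε => ⟨F, F.contDiff, fun x => by simp, fun x => by simpa using hε.le, ?_⟩⟩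
  simp [hF]

/-- Hyperplanes are null sets. -/
lemma nullSingletonClass_map_inner (Ω : Set E3) {n : E3} (hn : n ≠ 0) :
    NullSingletonClass ((volume.restrict Ω).map fun x : E3 => ⟪n, x⟫) := by
  refine ⟨fun c => ?_⟩
  have hm : Measurable fun x : E3 => ⟪n, x⟫ := by fun_prop
  rw [Measure.map_apply hm (measurableSet_singleton c)]
  refine Measure.restrict_le_self.absolutelyContinuous ?_
  set P : AffineSubspace ℝ E3 :=
    (AffineSubspace.mk' (0 : ℝ) ⊥ : AffineSubspace ℝ ℝ).comap
      ((innerSL ℝ n).toLinearMap.toAffineMap - AffineMap.const ℝ E3 c) with hP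
  have hmem : ∀ x, x ∈ P ↔ ⟪n, x⟫ = c := by
    intro x
    simp [hP, AffineSubspace.mem_comap, AffineSubspace.mem_mk', sub_eq_zero]
  have hset : (fun x : E3 => ⟪n, x⟫) ⁻¹' {c} = (P : Set E3) := by
    ext x
    simp [hmem]
  rw [hset]
  refine Measure.addHaar_affineSubspace volume P fun htop => ?_
  have h0 : ⟪n, (0 : E3)⟫ = c := (hmem 0).1 (htop ▸ AffineSubspace.mem_top ℝ E3 0)
  have h1 : ⟪n, n⟫ = c := (hmem n).1 (htop ▸ AffineSubspace.mem_top ℝ E3 n)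
  rw [inner_zero_right] at h0
  rw [← h0, inner_self_eq_zero] at h1
  exact hn h1

/-- The derivative of a laminate of two maps `f` and `g` with phase function `α`. -/
lemma hasFDerivAt_laminate {A B : E3 →L[ℝ] E3} {a n : E3} {l : ℝ} {α h : ℝ → ℝ} {f g : E3 → E3}
    (hAB : A - B = (innerSL ℝ n).smulRight a) (hα : ContDiff ℝ 1 α)
    (hh : ∀ s, HasDerivAt h (α s - l) s) (hf : ContDiff ℝ 1 f) (hg : ContDiff ℝ 1 g) (x : E3) :
    HasFDerivAt (fun x => (l • A + (1 - l) • B) x + h ⟪n, x⟫ • a + α ⟪n, x⟫ • (f x - A x) +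
        (1 - α ⟪n, x⟫) • (g x - B x))
      (α ⟪n, x⟫ • fderiv ℝ f x + (1 - α ⟪n, x⟫) • fderiv ℝ g x +
        (deriv α ⟪n, x⟫ • innerSL ℝ n).smulRight ((f x - A x) - (g x - B x))) x := by
  have hi : HasFDerivAt (fun x : E3 => ⟪n, x⟫) (innerSL ℝ n) x := (innerSL ℝ n).hasFDerivAt
  have h1 := (hh ⟪n, x⟫).comp_hasFDerivAt x hi
  have h2 := ((hα.differentiable one_ne_zero ⟪n, x⟫).hasDerivAt).comp_hasFDerivAt x hi
  have hfx := (hf.differentiable one_ne_zero x).hasFDerivAt.sub A.hasFDerivAt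
  have hgx := (hg.differentiable one_ne_zero x).hasFDerivAt.sub B.hasFDerivAt
  have key := (((l • A + (1 - l) • B).hasFDerivAt (x := x)).add (h1.smul_const a)).add
    (h2.smul hfx) |>.add ((h2.const_sub 1).smul hgx)
  refine key.congr_fderiv ?_
  have hA : A = B + (innerSL ℝ n).smulRight a := by rw [← hAB]; abel
  rw [hA]
  ext1 v
  simp only [Function.comp_apply, add_apply, sub_apply,
    smul_apply, ContinuousLinearMap.smulRight_apply,
    neg_apply, smul_eq_mul, innerSL_apply_apply, Pi.sub_apply]
  module

/-- Closure under rank-one convex combinations. -/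
lemma approxHull_laminate {Ω : Set E3} (hΩ : volume Ω ≠ ⊤) {S : Set (E3 →L[ℝ] E3)}
    {A B : E3 →L[ℝ] E3} (hA : A ∈ approxHull Ω S) (hB : B ∈ approxHull Ω S) {a n : E3}
    (hAB : A - B = (innerSL ℝ n).smulRight a) {l : ℝ} (hl0 : 0 ≤ l) (hl1 : l ≤ 1) :
    l • A + (1 - l) • B ∈ approxHull Ω S := by
  -- For `n = 0` the law of n · x would be an atom, but then the two matrices coincide.
  rcases eq_or_ne n 0 with rfl | hn
  · have : A = B := by
      rw [← sub_eq_zero, hAB]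
      ext1 v
      simp
    rw [this, show l • B + (1 - l) • B = B by module]
    exact hB
  obtain ⟨MA, hMA⟩ := hA
  obtain ⟨MB, hMB⟩ := hB
  refine ⟨MA + MB + 1, fun ε hε => ?_⟩
  have hmeas : Measurable fun x : E3 => ⟪n, x⟫ := by fun_prop
  set τ := (volume.restrict Ω).map fun x : E3 => ⟪n, x⟫ with hτdef
  have : Fact (volume Ω < ⊤) := ⟨hΩ.lt_top⟩
  have : IsFiniteMeasure τ := Measure.isFiniteMeasure_map _ _
  have : NullSingletonClass τ := nullSingletonClass_map_inner Ω hn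
  obtain ⟨η, hη⟩ : ∃ η : ℝ, η = ε / (4 * (‖a‖ + 1)) := ⟨_, rfl⟩
  have hη0 : 0 < η := hη ▸ by positivity
  have hηa : η * (‖a‖ + 1) = ε / 4 := by
    rw [hη]; field_simp
  have hηε : η ≤ ε / 4 := by nlinarith [norm_nonneg a]
  obtain ⟨α, h, hα, hh1, hh, hhb, hα0, hα1, ⟨C, hC⟩, hτ⟩ :=
    exists_laminate_profile τ hl0 hl1 hη0
  have hC0 : 0 ≤ C := (abs_nonneg _).trans (hC 0)
  -- The accuracy `δ` of the maps to be blended is chosen after the profile, hence after the bound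
  -- `C` on its derivative. The blending error in the gradient is then at most 1, which keeps the
  -- Lipschitz bound independent of `ε`.
  obtain ⟨δ, hδ0, hδε, hδC⟩ : ∃ δ : ℝ, 0 < δ ∧ δ ≤ ε / 4 ∧ C * ‖n‖ * (2 * δ) ≤ 1 := by
    refine ⟨min (ε / 4) (1 / (2 * (C * ‖n‖ + 1))), by positivity, min_le_left _ _, ?_⟩
    have hle := min_le_right (ε / 4) (1 / (2 * (C * ‖n‖ + 1)))
    have hCn : 0 ≤ C * ‖n‖ := by positivity
    calc C * ‖n‖ * (2 * min (ε / 4) (1 / (2 * (C * ‖n‖ + 1))))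
        ≤ C * ‖n‖ * (2 * (1 / (2 * (C * ‖n‖ + 1)))) := by gcongr
      _ = C * ‖n‖ / (C * ‖n‖ + 1) := by field_simp
      _ ≤ 1 := by rw [div_le_one (by positivity)]; linarith
  obtain ⟨f, hf, hfM, hfA, hfS⟩ := hMA δ hδ0
  obtain ⟨g, hg, hgM, hgB, hgS⟩ := hMB δ hδ0
  have hder := hasFDerivAt_laminate hAB hα hh hf hg
  refine ⟨fun x => (l • A + (1 - l) • B) x + h ⟪n, x⟫ • a + α ⟪n, x⟫ • (f x - A x) +
    (1 - α ⟪n, x⟫) • (g x - B x), ?_, fun x => ?_, fun x => ?_, ?_⟩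
  · have hA' := A.contDiff (n := 1)
    have hB' := B.contDiff (n := 1)
    have hL' := (l • A + (1 - l) • B).contDiff (n := 1)
    have hi : ContDiff ℝ 1 fun x : E3 => ⟪n, x⟫ := (innerSL ℝ n).contDiff
    exact ((hL'.add ((hh1.comp hi).smul contDiff_const)).add ((hα.comp hi).smul (hf.sub hA'))).add
      ((contDiff_const.sub (hα.comp hi)).smul (hg.sub hB'))
  · rw [(hder x).fderiv]
    have e1 : ‖α ⟪n, x⟫ • fderiv ℝ f x‖ ≤ MA := by
      rw [norm_smul, Real.norm_of_nonneg (hα0 _)]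
      exact (mul_le_of_le_one_left (norm_nonneg _) (hα1 _)).trans (hfM x)
    have e2 : ‖(1 - α ⟪n, x⟫) • fderiv ℝ g x‖ ≤ MB := by
      rw [norm_smul, Real.norm_of_nonneg (sub_nonneg.2 (hα1 _))]
      exact (mul_le_of_le_one_left (norm_nonneg _) (by linarith [hα0 ⟪n, x⟫])).trans (hgM x)
    have e3 : ‖(deriv α ⟪n, x⟫ • innerSL ℝ n).smulRight ((f x - A x) - (g x - B x))‖ ≤ 1 := by
      rw [ContinuousLinearMap.norm_smulRight_apply, norm_smul, innerSL_apply_norm]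
      refine le_trans ?_ hδC
      gcongr
      · exact hC _
      · exact (norm_sub_le _ _).trans (by linarith [hfA x, hgB x])
    exact (norm_add₃_le).trans (by linarith)
  · have e0 : ‖h ⟪n, x⟫ • a‖ ≤ ε / 4 := by
      rw [norm_smul, ← hηa]
      exact mul_le_mul (hhb _) (by linarith) (norm_nonneg _) hη0.le
    have e1 : ‖α ⟪n, x⟫ • (f x - A x)‖ ≤ ε / 4 := by
      rw [norm_smul, Real.norm_of_nonneg (hα0 _)]
      exact (mul_le_of_le_one_left (norm_nonneg _) (hα1 _)).trans ((hfA x).trans hδε)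
    have e2 : ‖(1 - α ⟪n, x⟫) • (g x - B x)‖ ≤ ε / 4 := by
      rw [norm_smul, Real.norm_of_nonneg (sub_nonneg.2 (hα1 _))]
      exact (mul_le_of_le_one_left (norm_nonneg _) (by linarith [hα0 ⟪n, x⟫])).trans
        ((hgB x).trans hδε)
    rw [show ∀ u v w z : E3, u + v + w + z - u = v + w + z from fun u v w z => by abel]
    exact (norm_add₃_le).trans (by linarith)
  · have hsub : {x | x ∈ Ω ∧ fderiv ℝ (fun x => (l • A + (1 - l) • B) x + h ⟪n, x⟫ • a +
        α ⟪n, x⟫ • (f x - A x) + (1 - α ⟪n, x⟫) • (g x - B x)) x ∉ S} ⊆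
        ({x | x ∈ Ω ∧ fderiv ℝ f x ∉ S} ∪ {x | x ∈ Ω ∧ fderiv ℝ g x ∉ S}) ∪
          ((fun x : E3 => ⟪n, x⟫) ⁻¹' {s | ¬ (α s = 0 ∨ α s = 1)} ∩ Ω) := by
      rintro x ⟨hxΩ, hxS⟩
      rw [(hder x).fderiv] at hxS
      -- Where `α` is 0 or 1 it is at an extremum, so its derivative vanishes and the gradient of
      -- the blend is exactly that of `g` or of `f`.
      by_cases hx : α ⟪n, x⟫ = 0 ∨ α ⟪n, x⟫ = 1
      · left
        rcases hx with hx | hx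
        · have hd : deriv α ⟪n, x⟫ = 0 :=
            IsLocalMin.deriv_eq_zero (Eventually.of_forall fun s => hx.le.trans (hα0 s))
          right
          refine ⟨hxΩ, ?_⟩
          convert hxS using 2
          ext1 v
          simp [hx, hd]
        · have hd : deriv α ⟪n, x⟫ = 0 :=
            IsLocalMax.deriv_eq_zero (Eventually.of_forall fun s => (hα1 s).trans hx.ge)
          left
          refine ⟨hxΩ, ?_⟩
          convert hxS using 2
          ext1 v
          simp [hx, hd]
      · exact Or.inr ⟨hx, hxΩ⟩
    have hms : MeasurableSet {s | ¬ (α s = 0 ∨ α s = 1)} :=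
      ((measurableSet_eq_fun hα.continuous.measurable measurable_const).union
        (measurableSet_eq_fun hα.continuous.measurable measurable_const)).compl
    rw [hτdef, Measure.map_apply hmeas hms, Measure.restrict_apply (hmeas hms)] at hτ
    calc _ ≤ _ := measure_mono hsub
      _ ≤ (ENNReal.ofReal δ + ENNReal.ofReal δ) + ENNReal.ofReal η :=
        (measure_union_le _ _).trans (add_le_add ((measure_union_le _ _).trans
          (add_le_add hfS hgS)) hτ)
      _ = ENNReal.ofReal (δ + δ + η) := by
        rw [ENNReal.ofReal_add (by positivity) hη0.le, ENNReal.ofReal_add hδ0.le hδ0.le]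
      _ ≤ ENNReal.ofReal ε := ENNReal.ofReal_le_ofReal (by linarith)

end Lamination

end CubicAustenite

namespace CubicAustenite

/-! ### From uniform approximation to the quasiconvex hull. -/

section Hull

/-- Integration by parts against a compactly supported function. -/
lemma integral_mul_fderiv_eq_neg_of_hasCompactSupport {u φ : E3 → ℝ} (hu : ContDiff ℝ 1 u)
    (hφ : ContDiff ℝ 1 φ) (hc : HasCompactSupport φ) (v : E3) :
    ∫ x, u x * fderiv ℝ φ x v = - ∫ x, fderiv ℝ u x v * φ x := by
  have hu' : Continuous fun x => fderiv ℝ u x v :=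
    (hu.continuous_fderiv one_ne_zero).clm_apply continuous_const
  have hφ' : Continuous fun x => fderiv ℝ φ x v :=
    (hφ.continuous_fderiv one_ne_zero).clm_apply continuous_const
  have hc' : HasCompactSupport fun x => fderiv ℝ φ x v := hc.fderiv_apply ℝ v
  exact integral_mul_fderiv_eq_neg_fderiv_mul_of_integrable
    ((hu'.mul hφ.continuous).integrable_of_hasCompactSupport hc.mul_left)
    ((hu.continuous.mul hφ').integrable_of_hasCompactSupport hc'.mul_left)
    ((hu.continuous.mul hφ.continuous).integrable_of_hasCompactSupport hc.mul_left)
    (fun x _ => hu.differentiable one_ne_zero x) (fun x _ => hφ.differentiable one_ne_zero x)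

/-- Partial derivatives of a uniformly small, uniformly Lipschitz sequence tend weakly* to zero. -/
lemma tendsto_integral_fderiv_mul {Ω : Set E3} (hΩ : MeasurableSet Ω) {u : ℕ → E3 → ℝ} {e : ℕ → ℝ}
    (he : Tendsto e atTop (𝓝 0)) (hu : ∀ j, ContDiff ℝ 1 (u j)) (hue : ∀ j x, |u j x| ≤ e j)
    {v : E3} {C : ℝ} (hC : ∀ j x, |fderiv ℝ (u j) x v| ≤ C) {h : E3 → ℝ}
    (hh : Integrable h (volume.restrict Ω)) :
    Tendsto (fun j => ∫ x in Ω, fderiv ℝ (u j) x v * h x) atTop (𝓝 0) := by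
  have hC0 : 0 ≤ C := (abs_nonneg _).trans (hC 0 0)
  have hcont : ∀ j, Continuous fun x => fderiv ℝ (u j) x v := fun j =>
    ((hu j).continuous_fderiv one_ne_zero).clm_apply continuous_const
  set H : E3 → ℝ := Ω.indicator h with hHdef
  have hH : Integrable H := (integrable_indicator_iff hΩ).2 hh
  have hint : ∀ j, ∫ x in Ω, fderiv ℝ (u j) x v * h x = ∫ x, fderiv ℝ (u j) x v * H x := by
    intro j
    rw [← integral_indicator hΩ]
    congr 1 with x
    by_cases hx : x ∈ Ω <;> simp [hHdef, hx]
  simp_rw [hint]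
  rw [Metric.tendsto_atTop]
  intro ε hε
  set η := ε / (2 * (C + 1)) with hη
  have hη0 : 0 < η := by positivity
  have hCη : C * η < ε / 2 := by
    rw [hη, mul_div_assoc', div_lt_iff₀ (by positivity)]
    nlinarith
  -- Replacing the density by a test function `φ` costs at most `C * η` uniformly in `j`; against
  -- `φ` the derivative is moved off `u j`, leaving a term bounded by `e j * D`.
  obtain ⟨φ, hφc, hφ, hφη⟩ := (memLp_one_iff_integrable.2 hH).exist_eLpNorm_sub_le
    ENNReal.one_ne_top le_rfl hη0
  have hφ1 : ContDiff ℝ 1 φ := hφ.of_le (by exact_mod_cast le_top)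
  have hφi : Integrable φ := hφ.continuous.integrable_of_hasCompactSupport hφc
  have hdiff : ∫ x, |H x - φ x| ≤ η := by
    have hn := eLpNorm_one_eq_lintegral_enorm (μ := (volume : Measure E3)) (f := H - φ)
    have := integral_norm_eq_lintegral_enorm (hH.sub hφi).aestronglyMeasurable
    simp only [Pi.sub_apply, Real.norm_eq_abs] at this
    rw [this]
    refine ENNReal.toReal_le_of_le_ofReal hη0.le ?_
    rw [hn] at hφη
    exact hφη
  set D : ℝ := ∫ x, |fderiv ℝ φ x v| with hD
  have hφ' : Continuous fun x => fderiv ℝ φ x v :=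
    (hφ1.continuous_fderiv one_ne_zero).clm_apply continuous_const
  have hφ'i : Integrable fun x => fderiv ℝ φ x v :=
    hφ'.integrable_of_hasCompactSupport (hφc.fderiv_apply ℝ v)
  have heD : Tendsto (fun j => e j * D) atTop (𝓝 0) := by simpa using he.mul_const D
  obtain ⟨N, hN⟩ := (heD.eventually_lt_const (half_pos hε)).exists_forall_of_atTop
  refine ⟨N, fun j hj => ?_⟩
  have hbd : ∀ᵐ x ∂(volume : Measure E3), ‖fderiv ℝ (u j) x v‖ ≤ C := Eventually.of_forall (hC j)
  have hi1 : Integrable fun x => fderiv ℝ (u j) x v * (H x - φ x) :=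
    (hH.sub hφi).bdd_mul (hcont j).aestronglyMeasurable hbd
  have hi2 : Integrable fun x => fderiv ℝ (u j) x v * φ x :=
    hφi.bdd_mul (hcont j).aestronglyMeasurable hbd
  have hsplit : ∫ x, fderiv ℝ (u j) x v * H x =
      (∫ x, fderiv ℝ (u j) x v * (H x - φ x)) - ∫ x, u j x * fderiv ℝ φ x v := by
    rw [integral_mul_fderiv_eq_neg_of_hasCompactSupport (hu j) hφ1 hφc v, sub_neg_eq_add,
      ← integral_add hi1 hi2]
    congr 1 with x
    ring
  have hb1 : |∫ x, fderiv ℝ (u j) x v * (H x - φ x)| ≤ C * η := by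
    refine (abs_integral_le_integral_abs).trans ?_
    calc ∫ x, |fderiv ℝ (u j) x v * (H x - φ x)| ≤ ∫ x, C * |H x - φ x| := by
          refine integral_mono hi1.abs ((hH.sub hφi).abs.const_mul C) fun x => ?_
          simp only [abs_mul]
          exact mul_le_mul_of_nonneg_right (hC j x) (abs_nonneg _)
      _ = C * ∫ x, |H x - φ x| := integral_const_mul _ _
      _ ≤ C * η := mul_le_mul_of_nonneg_left hdiff hC0
  have hb2 : |∫ x, u j x * fderiv ℝ φ x v| ≤ e j * D := by
    refine (abs_integral_le_integral_abs).trans ?_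
    rw [hD, ← integral_const_mul]
    have hi3 : Integrable fun x => u j x * fderiv ℝ φ x v :=
      hφ'i.bdd_mul (hu j).continuous.aestronglyMeasurable (Eventually.of_forall (hue j))
    refine integral_mono hi3.abs (hφ'i.abs.const_mul _) fun x => ?_
    simp only [abs_mul]
    exact mul_le_mul_of_nonneg_right (hue j x) (abs_nonneg _)
  rw [Real.dist_eq, sub_zero, hsplit]
  have := abs_sub (∫ x, fderiv ℝ (u j) x v * (H x - φ x)) (∫ x, u j x * fderiv ℝ φ x v)
  linarith [hN j hj]

/-- The `(i, k)` entry of the matrix of a linear map. -/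
noncomputable def entry (L : E3 →L[ℝ] E3) (i k : Fin 3) : ℝ := L (EuclideanSpace.single k 1) i

lemma entry_toEuclideanCLM (F : Mat3) (i k : Fin 3) :
    entry (Matrix.toEuclideanCLM (𝕜 := ℝ) F) i k = F i k := by
  simp [entry, Matrix.ofLp_toEuclideanCLM]

lemma abs_entry_le (L : E3 →L[ℝ] E3) (i k : Fin 3) : |entry L i k| ≤ ‖L‖ := by
  have h1 := PiLp.norm_apply_le (L (EuclideanSpace.single k 1)) i
  have h2 := L.le_opNorm (EuclideanSpace.single k 1)
  simp only [PiLp.norm_single, norm_one, mul_one] at h2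
  exact h1.trans h2

lemma fderiv_coord {f : E3 → E3} {x : E3} (hf : DifferentiableAt ℝ f x) (i k : Fin 3) :
    fderiv ℝ (fun x => f x i) x (EuclideanSpace.single k 1) = entry (fderiv ℝ f x) i k := by
  have h := ((EuclideanSpace.proj i : E3 →L[ℝ] ℝ).hasFDerivAt (x := f x)).comp x hf.hasFDerivAt
  have h' : HasFDerivAt (fun x => f x i) ((EuclideanSpace.proj i : E3 →L[ℝ] ℝ).comp
    (fderiv ℝ f x)) x := h
  rw [h'.fderiv]
  rfl

lemma contDiff_coord {f : E3 → E3} (hf : ContDiff ℝ 1 f) (i : Fin 3) :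
    ContDiff ℝ 1 fun x => f x i :=
  (EuclideanSpace.proj i : E3 →L[ℝ] ℝ).contDiff.comp hf

lemma continuous_entry_fderiv {f : E3 → E3} (hf : ContDiff ℝ 1 f) (i k : Fin 3) :
    Continuous fun x => entry (fderiv ℝ f x) i k :=
  (EuclideanSpace.proj i : E3 →L[ℝ] ℝ).continuous.comp
    ((hf.continuous_fderiv one_ne_zero).clm_apply continuous_const)

lemma isW1InftyMap_of_contDiff {Ω : Set E3} {f : E3 → E3}
    (hf : ContDiff ℝ 1 f) {M : ℝ} (hM : ∀ x, ‖fderiv ℝ f x‖ ≤ M) {M' : ℝ}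
    (hM' : ∀ᵐ x ∂(volume.restrict Ω), ‖f x‖ ≤ M') :
    IsW1InftyMap Ω f (fun x => Matrix.of fun i k => entry (fderiv ℝ f x) i k) where
  memLp_map i := by
    refine memLp_top_of_bound (contDiff_coord hf i).continuous.aestronglyMeasurable M' ?_
    filter_upwards [hM'] with x hx
    exact (PiLp.norm_apply_le (f x) i).trans hx
  memLp_grad i k := memLp_top_of_bound (continuous_entry_fderiv hf i k).aestronglyMeasurable M
    (Eventually.of_forall fun x => (abs_entry_le _ i k).trans (hM x))
  weak_grad := by
    intro φ hφ hc hs i k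
    have hφ1 : ContDiff ℝ 1 φ := hφ.of_le (by exact_mod_cast le_top)
    have key := integral_mul_fderiv_eq_neg_of_hasCompactSupport (contDiff_coord hf i) hφ1 hc
      (EuclideanSpace.single k 1)
    simp_rw [fderiv_coord (hf.differentiable one_ne_zero _)] at key
    rw [setIntegral_eq_integral_of_forall_compl_eq_zero,
      setIntegral_eq_integral_of_forall_compl_eq_zero]
    · exact key
    · intro x hx
      simp [image_eq_zero_of_notMem_tsupport fun h => hx (hs h)]
    · intro x hx
      have : fderiv ℝ φ x = 0 := by
        by_contra h0
        exact hx (hs (support_fderiv_subset ℝ h0))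
      simp [this]

/-- Approximable linear maps belong to the quasiconvex hull. -/
lemma mem_quasiconvexHull_of_mem_approxHull {Ω : Set E3} (hΩ : IsBoundedDomain Ω) {K : Set Mat3}
    {F : Mat3} (hF : Matrix.toEuclideanCLM (𝕜 := ℝ) F ∈
      approxHull Ω (Matrix.toEuclideanCLM (𝕜 := ℝ) '' K)) :
    F ∈ quasiconvexHull Ω K := by
  set L : E3 →L[ℝ] E3 := Matrix.toEuclideanCLM (𝕜 := ℝ) F with hL
  obtain ⟨M, hM⟩ := hF
  have hpos : ∀ j : ℕ, (0 : ℝ) < 1 / ((j : ℝ) + 1) := fun j => by positivity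
  choose f hf hfM hfF hfK using fun j : ℕ => hM (1 / ((j : ℝ) + 1)) (hpos j)
  have he : Tendsto (fun j : ℕ => 1 / ((j : ℝ) + 1)) atTop (𝓝 0) :=
    tendsto_one_div_add_atTop_nhds_zero_nat
  have he1 : ∀ j : ℕ, 1 / ((j : ℝ) + 1) ≤ 1 := fun j => by
    rw [div_le_one (by positivity)]
    linarith [(Nat.cast_nonneg j : (0 : ℝ) ≤ j)]
  obtain ⟨R, hR⟩ := hΩ.isBounded.exists_norm_le
  have hΩm : MeasurableSet Ω := hΩ.isOpen.measurableSet
  have hfin : volume Ω ≠ ⊤ := hΩ.isBounded.measure_lt_top.ne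
  have hfb : ∀ j, ∀ᵐ x ∂(volume.restrict Ω), ‖f j x‖ ≤ ‖L‖ * R + 1 := by
    intro j
    filter_upwards [ae_restrict_mem hΩm] with x hx
    have h1 := hfF j x
    have h2 : ‖L x‖ ≤ ‖L‖ * R := (L.le_opNorm x).trans
      (mul_le_mul_of_nonneg_left (hR x hx) (norm_nonneg _))
    calc ‖f j x‖ = ‖L x + (f j x - L x)‖ := by congr 1; abel
      _ ≤ _ := (norm_add_le _ _).trans (by linarith [he1 j])
  refine ⟨f, fun j x => Matrix.of fun i k => entry (fderiv ℝ (f j) x) i k,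
    fun j => isW1InftyMap_of_contDiff (hf j) (hfM j) (hfb j), ?_, ?_, ?_, ?_⟩
  · refine ⟨max (‖L‖ * R + 1) M, fun j => ?_⟩
    filter_upwards [hfb j] with x hx
    exact ⟨fun i => ((PiLp.norm_apply_le (f j x) i).trans hx).trans (le_max_left _ _),
      fun i k => ((abs_entry_le _ i k).trans (hfM j x)).trans (le_max_right _ _)⟩
  · intro i h hh
    refine tendsto_integral_of_dominated_convergence (fun x => (‖L‖ * R + 1) * ‖h x‖)
      (fun j => ?_) (hh.norm.const_mul _) (fun j => ?_) ?_
    · exact (contDiff_coord (hf j) i).continuous.aestronglyMeasurable.mul hh.aestronglyMeasurable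
    · filter_upwards [hfb j] with x hx
      rw [norm_mul]
      exact mul_le_mul_of_nonneg_right ((PiLp.norm_apply_le (f j x) i).trans hx) (norm_nonneg _)
    · refine Eventually.of_forall fun x => ?_
      refine Tendsto.mul_const _ ?_
      rw [tendsto_iff_norm_sub_tendsto_zero]
      exact squeeze_zero (fun _ => norm_nonneg _)
        (fun j => (PiLp.norm_apply_le (f j x - L x) i).trans (hfF j x)) he
  · intro i k h hh
    have hu : ∀ j, ContDiff ℝ 1 fun x => (f j x - L x) i := fun j =>
      contDiff_coord ((hf j).sub L.contDiff) i
    have hder : ∀ j x, fderiv ℝ (fun x => (f j x - L x) i) x (EuclideanSpace.single k 1) =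
        entry (fderiv ℝ (f j) x) i k - F i k := by
      intro j x
      have hd := (hf j).differentiable one_ne_zero x
      rw [fderiv_coord (f := fun x => f j x - L x) (hd.sub L.differentiableAt),
        fderiv_fun_sub hd L.differentiableAt, L.fderiv, ← entry_toEuclideanCLM F]
      simp [entry, hL]
    have hbd : ∀ j x, |entry (fderiv ℝ (f j) x) i k - F i k| ≤ M + |F i k| := fun j x =>
      (abs_sub _ _).trans (add_le_add_left ((abs_entry_le _ i k).trans (hfM j x)) _)
    have key := tendsto_integral_fderiv_mul hΩm he hu
      (fun j x => (PiLp.norm_apply_le (f j x - L x) i).trans (hfF j x))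
      (v := EuclideanSpace.single k 1) (C := M + |F i k|) (fun j x => by
        rw [hder]; exact hbd j x) hh
    simp_rw [hder] at key
    have hsum := key.add_const (∫ x in Ω, F i k * h x)
    rw [zero_add] at hsum
    refine hsum.congr fun j => ?_
    rw [← integral_add _ (hh.const_mul _)]
    · congr 1 with x
      simp only [Matrix.of_apply]
      ring
    · exact hh.bdd_mul ((continuous_entry_fderiv (hf j) i k).sub
        continuous_const).aestronglyMeasurable (Eventually.of_forall (hbd j))
  · intro V _ hKV
    refine tendsto_of_tendsto_of_tendsto_of_le_of_le tendsto_const_nhds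
      (h := fun j : ℕ => ENNReal.ofReal (1 / ((j : ℝ) + 1))) ?_ (fun _ => zero_le) fun j => ?_
    · simpa using ENNReal.tendsto_ofReal he
    · refine (measure_mono ?_).trans (hfK j)
      rintro x ⟨hx, hxV⟩
      refine ⟨hx, ?_⟩
      rintro ⟨F', hF', hFx⟩
      apply hxV
      have : (Matrix.of fun i k => entry (fderiv ℝ (f j) x) i k) = F' := by
        ext i k
        rw [Matrix.of_apply, ← hFx, entry_toEuclideanCLM]
      simp only [this]
      exact hKV hF'

end Hull

end CubicAustenite

namespace CubicAustenite

/-! ### Lamination hulls and the rotations of the cube. -/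

section Wells

open Matrix

/-- Closure of a set of matrices under rank-one convex combinations. -/
inductive LaminationHull (K : Set Mat3) : Mat3 → Prop
  | base {F : Mat3} (hF : F ∈ K) : LaminationHull K F
  | laminate {A B : Mat3} (hA : LaminationHull K A) (hB : LaminationHull K B) (a n : Fin 3 → ℝ)
      (hAB : A - B = vecMulVec a n) (l : ℝ) (hl0 : 0 ≤ l) (hl1 : l ≤ 1) :
      LaminationHull K (l • A + (1 - l) • B)

/-- The induction is carried by `approxHull` because its approximating maps can be blended directly:
they are defined on the whole space and close to their linear maps uniformly. -/
lemma LaminationHull.mem_quasiconvexHull {Ω : Set E3} (hΩ : IsBoundedDomain Ω) {K : Set Mat3}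
    {F : Mat3} (hF : LaminationHull K F) : F ∈ quasiconvexHull Ω K := by
  refine mem_quasiconvexHull_of_mem_approxHull hΩ ?_
  induction hF with
  | base hF => exact subset_approxHull Ω _ ⟨_, hF, rfl⟩
  | laminate _ _ a n hAB l hl0 hl1 ihA ihB =>
    rw [map_add, map_smul, map_smul]
    refine approxHull_laminate hΩ.isBounded.measure_lt_top.ne ihA ihB
      (a := WithLp.toLp 2 a) (n := WithLp.toLp 2 n) ?_ hl0 hl1
    rw [← map_sub, hAB]
    ext x i
    simp [Matrix.ofLp_toEuclideanCLM, vecMulVec_mulVec, EuclideanSpace.inner_eq_star_dotProduct,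
      dotProduct_comm, mul_comm]

lemma LaminationHull.mul_left {K : Set Mat3} {Q : Mat3} (hQ : ∀ F ∈ K, Q * F ∈ K) {F : Mat3}
    (hF : LaminationHull K F) : LaminationHull K (Q * F) := by
  induction hF with
  | base hF => exact .base (hQ _ hF)
  | laminate _ _ a n hAB l hl0 hl1 ihA ihB =>
    rw [mul_add, mul_smul_comm, mul_smul_comm]
    refine .laminate ihA ihB (Q *ᵥ a) n ?_ l hl0 hl1
    rw [← mul_sub, hAB, mul_vecMulVec]

lemma LaminationHull.mul_right {K : Set Mat3} {R : Mat3} (hR : ∀ F ∈ K, F * R ∈ K) {F : Mat3}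
    (hF : LaminationHull K F) : LaminationHull K (F * R) := by
  induction hF with
  | base hF => exact .base (hR _ hF)
  | laminate _ _ a n hAB l hl0 hl1 ihA ihB =>
    rw [add_mul, smul_mul_assoc, smul_mul_assoc]
    refine .laminate ihA ihB a (n ᵥ* R) ?_ l hl0 hl1
    rw [← sub_mul, hAB, vecMulVec_mul]

lemma mul_mem_SO3 {Q R : Mat3} (hQ : Q ∈ SO3) (hR : R ∈ SO3) : Q * R ∈ SO3 := by
  refine ⟨?_, by rw [det_mul, hQ.2, hR.2, one_mul]⟩
  rw [transpose_mul, Matrix.mul_assoc, ← Matrix.mul_assoc Qᵀ, hQ.1, Matrix.one_mul, hR.1]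

lemma one_mem_SO3 : (1 : Mat3) ∈ SO3 := by
  simp [SO3]

lemma mul_mem_P24 {Q R : Mat3} (hQ : Q ∈ P24) (hR : R ∈ P24) : Q * R ∈ P24 := by
  refine ⟨mul_mem_SO3 hQ.1 hR.1, ?_⟩
  have : (fun x => (Q * R) *ᵥ x) = (fun x => Q *ᵥ x) ∘ fun x => R *ᵥ x := by
    ext1 x
    simp
  rw [this, Set.image_comp, hR.2, hQ.2]

lemma one_mem_P24 : (1 : Mat3) ∈ P24 := ⟨one_mem_SO3, by simp⟩

lemma mulVec_mem_cube {R : Mat3} (hR : ∀ i, ∑ j, |R i j| ≤ 1) {x : Fin 3 → ℝ} (hx : x ∈ cube) :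
    R *ᵥ x ∈ cube := by
  intro i
  calc |(R *ᵥ x) i| = |∑ j, R i j * x j| := rfl
    _ ≤ ∑ j, |R i j * x j| := Finset.abs_sum_le_sum_abs _ _
    _ ≤ ∑ j, |R i j| := Finset.sum_le_sum fun j _ => by
        rw [abs_mul]
        exact mul_le_of_le_one_right (abs_nonneg _) (hx j)
    _ ≤ 1 := hR i

/-- Row sums control the image of the cube under `R`; column sums control it under `Rᵀ`, the inverse
of `R`, which gives surjectivity. -/
lemma mem_P24_of_sum_abs_le {R : Mat3} (hR : R ∈ SO3) (hrow : ∀ i, ∑ j, |R i j| ≤ 1)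
    (hcol : ∀ j, ∑ i, |R i j| ≤ 1) : R ∈ P24 := by
  refine ⟨hR, Set.Subset.antisymm ?_ fun x hx => ⟨Rᵀ *ᵥ x, mulVec_mem_cube hcol hx, ?_⟩⟩
  · rintro _ ⟨x, hx, rfl⟩
    exact mulVec_mem_cube hrow hx
  · simp [mul_eq_one_comm.1 hR.1]

/-- Rotation by `π` about the axis `v`. -/
noncomputable def halfTurn (v : Fin 3 → ℝ) : Mat3 := (2 / (v ⬝ᵥ v)) • vecMulVec v v - 1

lemma halfTurn_mulVec (v x : Fin 3 → ℝ) :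
    halfTurn v *ᵥ x = (2 * (v ⬝ᵥ x) / (v ⬝ᵥ v)) • v - x := by
  rw [halfTurn, sub_mulVec, smul_mulVec, vecMulVec_mulVec, one_mulVec]
  ext i
  simp
  ring

lemma halfTurn_mem_SO3 {v : Fin 3 → ℝ} (hv : v ⬝ᵥ v ≠ 0) : halfTurn v ∈ SO3 := by
  have ht : (halfTurn v)ᵀ = halfTurn v := by
    simp [halfTurn, transpose_vecMulVec]
  constructor
  · rw [ht]
    refine Matrix.ext_of_mulVec_single fun i => ?_
    rw [← mulVec_mulVec, halfTurn_mulVec, halfTurn_mulVec, one_mulVec, dotProduct_sub,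
      dotProduct_smul, smul_eq_mul, div_mul_cancel₀ _ hv]
    ext a
    simp
    ring
  · have hdet : ∀ c : ℝ, (c • vecMulVec v v - 1 : Mat3).det = c * (v ⬝ᵥ v) - 1 := by
      intro c
      rw [det_fin_three]
      simp [vecMulVec_apply, dotProduct, Fin.sum_univ_three]
      ring
    rw [halfTurn, hdet, div_mul_cancel₀ _ hv]
    norm_num

lemma halfTurn_single (i : Fin 3) :
    halfTurn (Pi.single i 1) = diagonal fun a => if a = i then 1 else -1 := by
  ext a b
  obtain rfl | hab := eq_or_ne a b
  · by_cases ha : a = i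
    · norm_num [halfTurn, vecMulVec_apply, ha]
    · simp [halfTurn, vecMulVec_apply, ha]
  · by_cases ha : a = i
    · have hb : b ≠ i := fun h => hab (ha.trans h.symm)
      simp [halfTurn, vecMulVec_apply, hab, hb]
    · simp [halfTurn, vecMulVec_apply, hab, ha]

lemma halfTurn_single_mem_P24 (i : Fin 3) : halfTurn (Pi.single i 1) ∈ P24 := by
  refine mem_P24_of_sum_abs_le (halfTurn_mem_SO3 (by simp)) ?_ ?_ <;>
  · intro a
    rw [Finset.sum_eq_single a]
    · rw [halfTurn_single, diagonal_apply_eq]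
      split_ifs <;> simp
    · intro b _ hb
      simp [halfTurn_single, hb, hb.symm]
    · simp

lemma fin_three_cases (i : Fin 3) : i = 0 ∨ i = 1 ∨ i = 2 := by
  revert i
  decide

lemma halfTurn_single_add (a b : Fin 3) (hab : a ≠ b) {r : ℝ} (hr : r ^ 2 = 1) :
    halfTurn (Pi.single a 1 + Pi.single b r) =
      vecMulVec (Pi.single a 1 + Pi.single b r) (Pi.single a 1 + Pi.single b r) - 1 := by
  have : (Pi.single a 1 + Pi.single b r : Fin 3 → ℝ) ⬝ᵥ (Pi.single a 1 + Pi.single b r) = 2 := by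
    simp [hab, hab.symm, ← sq, hr]
    norm_num
  rw [halfTurn, this, div_self two_ne_zero, one_smul]

/-- The axis is a face diagonal; the half-turn about it is a signed permutation matrix, exchanging
the axes `a` and `b` up to sign and reversing the third. -/
lemma halfTurn_single_add_mem_P24 {a b : Fin 3} (hab : a ≠ b) {r : ℝ} (hr : r = 1 ∨ r = -1) :
    halfTurn (Pi.single a 1 + Pi.single b r) ∈ P24 := by
  have hr2 : r ^ 2 = 1 := by rcases hr with rfl | rfl <;> norm_num
  refine mem_P24_of_sum_abs_le (halfTurn_mem_SO3 ?_) ?_ ?_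
  · simp [hab, hab.symm, ← sq, hr2]
  all_goals
    rw [halfTurn_single_add a b hab hr2]
    intro i
    rcases hr with rfl | rfl <;> obtain rfl | rfl | rfl := fin_three_cases a <;>
      obtain rfl | rfl | rfl := fin_three_cases b <;>
      first
        | exact absurd rfl hab
        | (obtain rfl | rfl | rfl := fin_three_cases i <;>
            simp [Fin.sum_univ_three, vecMulVec_apply])

/-- Sets of matrices closed under rank-one convex combinations, rotations of the deformed
configuration and symmetry operations of the cube. -/
structure IsSymmetricLaminationClosed (H : Set Mat3) : Prop where
  laminate : ∀ {A B : Mat3}, A ∈ H → B ∈ H → ∀ a n : Fin 3 → ℝ, A - B = vecMulVec a n →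
    ∀ l : ℝ, 0 ≤ l → l ≤ 1 → l • A + (1 - l) • B ∈ H
  mul_left : ∀ {Q F : Mat3}, Q ∈ SO3 → F ∈ H → Q * F ∈ H
  mul_right : ∀ {R F : Mat3}, R ∈ P24 → F ∈ H → F * R ∈ H

/-- Both group actions preserve the wells and send rank-one differences to rank-one differences. On
the right, inserting R Rᵀ = 1 after the rotation `Q'` turns the factor `R` into a change of variant.
-/
lemma isSymmetricLaminationClosed_wells (U : Mat3) :
    IsSymmetricLaminationClosed {F | LaminationHull (wells U) F} where
  laminate hA hB a n hAB l hl0 hl1 := .laminate hA hB a n hAB l hl0 hl1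
  mul_left hQ hF := LaminationHull.mul_left (by
    rintro _ ⟨R, hR, Q', hQ', rfl⟩
    exact ⟨R, hR, _, mul_mem_SO3 hQ hQ', (Matrix.mul_assoc _ _ _).symm⟩) hF
  mul_right {R F} hR hF := LaminationHull.mul_right (by
    rintro _ ⟨R', hR', Q', hQ', rfl⟩
    refine ⟨R' * R, mul_mem_P24 hR' hR, _, mul_mem_SO3 hQ' hR.1, ?_⟩
    have h1 : R * Rᵀ = 1 := mul_eq_one_comm.1 hR.1.1
    calc Q' * (R'ᵀ * U * R') * R = Q' * (1 * (R'ᵀ * U * R')) * R := by rw [Matrix.one_mul]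
      _ = Q' * R * ((R' * R)ᵀ * U * (R' * R)) := by
        rw [← h1, transpose_mul]
        simp only [Matrix.mul_assoc]) hF

/-! ### Twinning and its effect on Cauchy–Green tensors. -/

namespace IsSymmetricLaminationClosed

variable {H : Set Mat3}

/-- Laminates of two wells related by a rotation of angle `π` in the symmetry group. -/
lemma exists_twin_laminate (hH : IsSymmetricLaminationClosed H) {F : Mat3} (hF : F ∈ H)
    (hdet : 0 < F.det) {v : Fin 3 → ℝ} (hv : v ⬝ᵥ v ≠ 0) (hR : halfTurn v ∈ P24) {t : ℝ}
    (ht0 : -1 ≤ t) (ht1 : t ≤ 1) :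
    ∃ G ∈ H, G.det = F.det ∧
      (∀ x y, v ⬝ᵥ x = 0 → v ⬝ᵥ y = 0 → x ⬝ᵥ (Gᵀ * G) *ᵥ y = x ⬝ᵥ (Fᵀ * F) *ᵥ y) ∧
      ∀ x, v ⬝ᵥ x = 0 → v ⬝ᵥ (Gᵀ * G) *ᵥ x = t * (v ⬝ᵥ (Fᵀ * F) *ᵥ x) := by
  have hu : IsUnit F.det := hdet.ne'.isUnit
  have hgram : ∀ (A : Mat3) (x y : Fin 3 → ℝ), x ⬝ᵥ (Aᵀ * A) *ᵥ y = (A *ᵥ x) ⬝ᵥ (A *ᵥ y) := by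
    intro A x y
    rw [← mulVec_mulVec, dotProduct_mulVec, vecMul_transpose]
  -- m = F⁻ᵀ v is normal to the image under `F` of the plane orthogonal to `v`. On that plane the
  -- half-turn about `v` is -1, and on its image so is the half-turn about `m`; hence the twin `B`
  -- below agrees with `F` there, and F - B = a ⊗ v.
  obtain ⟨m, hm⟩ : ∃ m : Fin 3 → ℝ, ∀ x, m ⬝ᵥ F *ᵥ x = v ⬝ᵥ x := by
    refine ⟨v ᵥ* F⁻¹, fun x => ?_⟩
    rw [← dotProduct_mulVec, mulVec_mulVec, nonsing_inv_mul F hu, one_mulVec]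
  have hmm : m ⬝ᵥ m ≠ 0 := by
    intro h0
    rw [dotProduct_self_eq_zero] at h0
    apply hv
    rw [← hm v, h0, zero_dotProduct]
  set B : Mat3 := halfTurn m * F * halfTurn v with hBdef
  have hB : B ∈ H := hH.mul_right hR (hH.mul_left (halfTurn_mem_SO3 hmm) hF)
  set a : Fin 3 → ℝ := (2 / (v ⬝ᵥ v)) • F *ᵥ v - (2 / (m ⬝ᵥ m)) • m with ha
  have hBx : ∀ x, B *ᵥ x = F *ᵥ x - (v ⬝ᵥ x) • a := by
    intro x
    have h1 : v ⬝ᵥ (halfTurn v *ᵥ x) = v ⬝ᵥ x := by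
      rw [halfTurn_mulVec, dotProduct_sub, dotProduct_smul, smul_eq_mul, div_mul_cancel₀ _ hv]
      ring
    rw [hBdef, ← mulVec_mulVec, ← mulVec_mulVec, halfTurn_mulVec m, hm, h1, halfTurn_mulVec,
      mulVec_sub, mulVec_smul, ha]
    ext i
    simp
    ring
  have hFB : F - B = vecMulVec a v := by
    refine Matrix.ext_of_mulVec_single fun i => ?_
    rw [sub_mulVec, hBx, vecMulVec_mulVec]
    ext b
    simp [mul_comm]
  -- With weight (1 + t) / 2 on `F`, the vector G v is t F v plus a multiple of `m`. Since `m` is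
  -- orthogonal to the image of the plane, exactly the factor `t` survives in the shears.
  have hG := hH.laminate hF hB a v hFB ((1 + t) / 2) (by linarith) (by linarith)
  set G : Mat3 := ((1 + t) / 2) • F + (1 - (1 + t) / 2) • B with hGdef
  have hGx : ∀ x, G *ᵥ x = F *ᵥ x - ((1 - t) / 2 * (v ⬝ᵥ x)) • a := by
    intro x
    rw [hGdef, add_mulVec, smul_mulVec, smul_mulVec, hBx]
    module
  have hperp : ∀ x, v ⬝ᵥ x = 0 → G *ᵥ x = F *ᵥ x := fun x hx => by simp [hGx, hx]
  refine ⟨G, hG, ?_, ?_, ?_⟩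
  -- G = F (1 + p ⊗ v) with v · p = 0, because v · F⁻¹a = m · a = 0; the second factor has
  -- determinant 1.
  · have hvec : ∀ p q : Fin 3 → ℝ, (1 + vecMulVec p q : Mat3).det = 1 + q ⬝ᵥ p := by
      intro p q
      rw [det_fin_three]
      simp [vecMulVec_apply, dotProduct, Fin.sum_univ_three]
      ring
    set p : Fin 3 → ℝ := (-((1 - t) / 2)) • (F⁻¹ *ᵥ a) with hp
    have hFp : F *ᵥ (F⁻¹ *ᵥ a) = a := by
      rw [mulVec_mulVec, mul_nonsing_inv F hu, one_mulVec]
    have hGF : G = F * (1 + vecMulVec p v) := by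
      refine Matrix.ext_of_mulVec_single fun i => ?_
      rw [hGx, ← mulVec_mulVec, add_mulVec, one_mulVec, vecMulVec_mulVec, mulVec_add, hp]
      rw [op_smul_eq_smul, mulVec_smul, mulVec_smul, hFp]
      module
    have hvp : v ⬝ᵥ p = 0 := by
      have h1 : v ⬝ᵥ (F⁻¹ *ᵥ a) = 0 := by
        rw [← hm, hFp, ha, dotProduct_sub, dotProduct_smul, dotProduct_smul, hm, smul_eq_mul,
          smul_eq_mul, div_mul_cancel₀ _ hv, div_mul_cancel₀ _ hmm, sub_self]
      rw [hp, dotProduct_smul, h1, smul_zero]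
    rw [hGF, det_mul, hvec, hvp, add_zero, mul_one]
  · intro x y hx hy
    rw [hgram, hgram, hperp x hx, hperp y hy]
  · intro x hx
    have hGv : G *ᵥ v = t • F *ᵥ v + ((1 - t) * (v ⬝ᵥ v) / (m ⬝ᵥ m)) • m := by
      rw [hGx, ha]
      ext i
      simp
      field_simp
      ring
    rw [hgram, hgram, hperp x hx, hGv, add_dotProduct, smul_dotProduct, smul_dotProduct, hm, hx]
    simp

/-- Lamination along a coordinate axis removes the shear components in that direction. -/
lemma exists_axis_laminate (hH : IsSymmetricLaminationClosed H) {F : Mat3} (hF : F ∈ H)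
    (hdet : 0 < F.det) (i : Fin 3) :
    ∃ G ∈ H, G.det = F.det ∧ (∀ a b, a ≠ i → b ≠ i → (Gᵀ * G) a b = (Fᵀ * F) a b) ∧
      ∀ a, a ≠ i → (Gᵀ * G) i a = 0 := by
  obtain ⟨G, hG, hGdet, h1, h2⟩ := hH.exists_twin_laminate hF hdet (v := Pi.single i 1) (by simp)
    (halfTurn_single_mem_P24 i) (t := 0) (by norm_num) (by norm_num)
  refine ⟨G, hG, hGdet, fun a b ha hb => ?_, fun a ha => ?_⟩
  · simpa using h1 (Pi.single a 1) (Pi.single b 1) (by simp [ha.symm]) (by simp [hb.symm])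
  · simpa using h2 (Pi.single a 1) (by simp [ha.symm])

/-- The stretch tensor of a diagonal Cauchy–Green tensor. -/
lemma diagonal_mem (hH : IsSymmetricLaminationClosed H) {G : Mat3} (hG : G ∈ H)
    (hdet : 0 < G.det) {d : Fin 3 → ℝ} (hd : ∀ i, 0 < d i)
    (hGd : Gᵀ * G = diagonal fun i => d i ^ 2) : diagonal d ∈ H := by
  have hu : IsUnit G.det := hdet.ne'.isUnit
  have hinv : G⁻¹ * G = 1 := nonsing_inv_mul G hu
  have hinv' : G * G⁻¹ = 1 := mul_nonsing_inv G hu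
  have hQ : diagonal d * G⁻¹ ∈ SO3 := by
    constructor
    · have hsq : diagonal d * diagonal d = Gᵀ * G := by
        rw [hGd, diagonal_mul_diagonal]
        simp only [sq]
      rw [transpose_mul, diagonal_transpose, Matrix.mul_assoc, ← Matrix.mul_assoc (diagonal d), hsq,
        Matrix.mul_assoc, hinv', Matrix.mul_one, ← transpose_mul, hinv', transpose_one]
    · have h1 := congrArg det hGd
      rw [det_mul, det_transpose, det_diagonal, Finset.prod_pow, ← sq] at h1
      have hp : 0 < ∏ i, d i := Finset.prod_pos fun i _ => hd i
      have h2 : G.det = ∏ i, d i := (pow_left_inj₀ hdet.le hp.le two_ne_zero).1 h1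
      rw [det_mul, det_diagonal, ← h2, ← det_mul, hinv', det_one]
  have := hH.mul_left hQ hG
  rwa [Matrix.mul_assoc, hinv, Matrix.mul_one] at this

/-- Conjugation by the half-turn about e_a + e_b, which is its own inverse, exchanges two diagonal
entries; the signs cancel. -/
lemma diagonal_comp_swap_mem (hH : IsSymmetricLaminationClosed H) {d : Fin 3 → ℝ}
    (hd : diagonal d ∈ H) {a b : Fin 3} (hab : a ≠ b) : diagonal (d ∘ Equiv.swap a b) ∈ H := by
  have hR := halfTurn_single_add_mem_P24 hab (Or.inl rfl)
  have := hH.mul_left hR.1 (hH.mul_right hR hd)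
  convert this using 1
  rw [halfTurn_single_add a b hab (by norm_num)]
  ext i j
  obtain rfl | rfl | rfl := fin_three_cases a <;> obtain rfl | rfl | rfl := fin_three_cases b <;>
    first
      | exact absurd rfl hab
      | (obtain rfl | rfl | rfl := fin_three_cases i <;>
          obtain rfl | rfl | rfl := fin_three_cases j <;>
          simp [Matrix.mul_apply, Fin.sum_univ_three, vecMulVec_apply, Equiv.swap_apply_def])

lemma diagonal_comp_perm_mem (hH : IsSymmetricLaminationClosed H) (π : Equiv.Perm (Fin 3)) :
    ∀ {d : Fin 3 → ℝ}, diagonal d ∈ H → diagonal (d ∘ π) ∈ H := by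
  induction π using Equiv.Perm.swap_induction_on with
  | one => exact fun hd => hd
  | swap_mul f x y hxy ih => exact fun hd => ih (hH.diagonal_comp_swap_mem hd hxy)

end IsSymmetricLaminationClosed

end Wells

end CubicAustenite

namespace CubicAustenite

/-! ### Explicit laminates leading to the three wells. -/

section ThreeWells

open Matrix

lemma det_eq_mul_cof {A : Mat3} {j : Fin 3} (hA : ∀ a, a ≠ j → A j a = 0) :
    A.det = A j j * cof A j j := by
  rw [det_eq_sum_mul_adjugate_row A j, Finset.sum_eq_single j]
  · rfl
  · intro b _ hb
    rw [hA b hb, zero_mul]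
  · simp

lemma cof_congr {A B : Mat3} {j : Fin 3} (h : ∀ a b, a ≠ j → b ≠ j → A a b = B a b) :
    cof A j j = cof B j j := by
  simp only [cof, transpose_apply, adjugate_fin_three]
  obtain rfl | rfl | rfl := fin_three_cases j <;>
    simp [h 0 0, h 0 1, h 0 2, h 1 0, h 1 1, h 1 2, h 2 0, h 2 1, h 2 2]

namespace IsSymmetricLaminationClosed

variable {H : Set Mat3}

/-- Two successive axial laminations turn a positive definite stretch into a diagonal one whose
diagonal entries are the three numbers `stretches`. -/
lemma exists_perm_diagonal_stretches_mem (hH : IsSymmetricLaminationClosed H) {U : Mat3}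
    (hU : U.PosDef) (hUH : U ∈ H) {j k : Fin 3} (hjk : j ≠ k) :
    (∀ i, 0 < stretches U U.det j k i) ∧
      ∃ π : Equiv.Perm (Fin 3), diagonal (stretches U U.det j k ∘ π) ∈ H := by
  have hdet : 0 < U.det := hU.det_pos
  have hUU : Uᵀ * U = U ^ 2 := by
    have : Uᵀ = U := by simpa [conjTranspose_eq_transpose_of_trivial] using hU.isHermitian.eq
    rw [this, sq]
  obtain ⟨l, hlj, hlk, hcases⟩ : ∃ l, l ≠ j ∧ l ≠ k ∧ ∀ i, i = j ∨ i = l ∨ i = k := by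
    revert j k
    decide
  -- Axis `j` is decoupled before the third axis `l`. The second lamination retains the zero already
  -- created in position (j, k), so all off-diagonal entries vanish.
  obtain ⟨G₁, hG₁, hd₁, h₁, h₁'⟩ := hH.exists_axis_laminate hUH hdet j
  obtain ⟨G₂, hG₂, hd₂, h₂, h₂'⟩ := hH.exists_axis_laminate hG₁ (hd₁ ▸ hdet) l
  have hd₂U : G₂.det = U.det := hd₂.trans hd₁
  set d : Fin 3 → ℝ := fun i => (G₂ᵀ * G₂) i i with hd
  have hsymm : ∀ (A : Mat3) a b, (Aᵀ * A) a b = (Aᵀ * A) b a := fun A a b => by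
    simp [Matrix.mul_apply, mul_comm]
  have hdiag : G₂ᵀ * G₂ = diagonal d := by
    have hjk0 : (G₂ᵀ * G₂) j k = 0 := by
      rw [h₂ j k hlj.symm hlk.symm, h₁' k hjk.symm]
    have hlj0 := h₂' j hlj.symm
    have hlk0 := h₂' k hlk.symm
    ext a b
    obtain rfl | hab := eq_or_ne a b
    · simp [hd]
    · rw [diagonal_apply_ne _ hab]
      obtain rfl | rfl | rfl := hcases a <;> obtain rfl | rfl | rfl := hcases b <;>
        first
          | exact absurd rfl hab
          | assumption
          | (rw [hsymm]; assumption)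
  have hdnn : ∀ i, 0 ≤ d i := fun i => by
    simp only [hd, Matrix.mul_apply, transpose_apply]
    exact Finset.sum_nonneg fun x _ => mul_self_nonneg _
  have hprod : d j * (d l * d k) = U.det ^ 2 := by
    have h := congrArg det hdiag
    rw [det_mul, det_transpose, det_diagonal, hd₂U, ← sq] at h
    rw [h, ← Finset.prod_subset (Finset.subset_univ {j, l, k})]
    · rw [Finset.prod_insert, Finset.prod_insert, Finset.prod_singleton]
      · simpa using hlk
      · simpa using ⟨hlj.symm, hjk⟩
    · intro x _ hx
      exact absurd (hcases x) (by simpa using hx)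
  have hprod0 : d j * (d l * d k) ≠ 0 := hprod ▸ (pow_pos hdet 2).ne'
  have hdpos : ∀ i, 0 < d i := fun i => by
    refine lt_of_le_of_ne (hdnn i) fun h0 => hprod0 ?_
    obtain rfl | rfl | rfl := hcases i <;> simp [← h0]
  have hdk : d k = (U ^ 2) k k := by
    rw [← hUU, ← h₁ k k hjk.symm hjk.symm, ← h₂ k k hlk.symm hlk.symm]
  -- After the first lamination the tensor splits as a 1 × 1 block and the untouched 2 × 2 block of
  -- U², so conservation of the determinant fixes the `j` entry.
  have hdj : d j * cof (U ^ 2) j j = U.det ^ 2 := by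
    have hdj' : d j = (G₂ᵀ * G₂) j j := rfl
    rw [← hUU, ← cof_congr h₁, hdj', h₂ j j hlj.symm hlj.symm, ← det_eq_mul_cof h₁', det_mul,
      det_transpose, hd₁, ← sq]
  have hcof : cof (U ^ 2) j j = d l * d k :=
    mul_left_cancel₀ (hdpos j).ne' (hdj.trans hprod.symm)
  have e0 : U.det / √(cof (U ^ 2) j j) = √(d j) := by
    have hp : 0 < d l * d k := mul_pos (hdpos l) (hdpos k)
    rw [hcof, div_eq_iff (Real.sqrt_pos.2 hp).ne', ← Real.sqrt_mul (hdnn j), hprod,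
      Real.sqrt_sq hdet.le]
  have e1 : √(cof (U ^ 2) j j / (U ^ 2) k k) = √(d l) := by
    rw [hcof, ← hdk, mul_div_cancel_right₀ _ (hdpos k).ne']
  have e2 : √((U ^ 2) k k) = √(d k) := by rw [hdk]
  obtain ⟨π, hπj, hπl, hπk⟩ : ∃ π : Equiv.Perm (Fin 3), π j = 0 ∧ π l = 1 ∧ π k = 2 := by
    clear * - hlj hlk hjk
    revert j k l
    decide
  have hst : stretches U U.det j k ∘ π = fun i => √(d i) := by
    ext i
    obtain rfl | rfl | rfl := hcases i
    · simp [stretches, hπj, e0]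
    · simp [stretches, hπl, e1]
    · simp [stretches, hπk, e2]
  have hpos : ∀ i, 0 < (stretches U U.det j k ∘ π) i := fun i => by
    rw [hst]
    exact Real.sqrt_pos.2 (hdpos i)
  refine ⟨fun i => by simpa using hpos (π.symm i), π, ?_⟩
  refine hH.diagonal_mem hG₂ (hd₂U ▸ hdet) hpos ?_
  rw [hdiag, hst]
  congr 1
  ext i
  exact (Real.sq_sqrt (hdnn i)).symm

/-- Laminates of `diag(μ, ν, ξ)` and `diag(μ, ξ, ν)` reach `diag(μ, √(νξ), √(νξ))`. -/
lemma diagonal_sqrt_mem (hH : IsSymmetricLaminationClosed H) {μ ν ξ : ℝ} (hμ : 0 < μ)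
    (hν : 0 < ν) (hξ : 0 < ξ) (hF : diagonal ![μ, ν, ξ] ∈ H) :
    diagonal ![μ, √(ν * ξ), √(ν * ξ)] ∈ H := by
  have hdetF : (diagonal ![μ, ν, ξ] : Mat3).det = μ * ν * ξ := by
    simp [det_diagonal, Fin.prod_univ_three]
  have hpos : 0 < (diagonal ![μ, ν, ξ] : Mat3).det := by rw [hdetF]; positivity
  have hFF : (diagonal ![μ, ν, ξ] : Mat3)ᵀ * diagonal ![μ, ν, ξ] =
      diagonal ![μ ^ 2, ν ^ 2, ξ ^ 2] := by
    rw [diagonal_transpose, diagonal_mul_diagonal]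
    congr 1
    ext i
    fin_cases i <;> simp [sq]
  have hsymm : ∀ (A : Mat3) a b, (Aᵀ * A) a b = (Aᵀ * A) b a := fun A a b => by
    simp [Matrix.mul_apply, mul_comm]
  have hv : (Pi.single 1 1 + Pi.single 2 1 : Fin 3 → ℝ) = ![0, 1, 1] := by
    ext i; fin_cases i <;> simp
  have hw : (Pi.single 1 1 + Pi.single 2 (-1) : Fin 3 → ℝ) = ![0, 1, -1] := by
    ext i; fin_cases i <;> simp
  have hRv : halfTurn ![0, 1, 1] ∈ P24 :=
    hv ▸ halfTurn_single_add_mem_P24 (by decide) (Or.inl rfl)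
  have hRw : halfTurn ![0, 1, -1] ∈ P24 :=
    hw ▸ halfTurn_single_add_mem_P24 (by decide) (Or.inr rfl)
  -- With v = (0, 1, 1) and w = (0, 1, -1), the first laminate has w · Mw = ν² + ξ² and v · Mw =
  -- t(ν² - ξ²), and the determinant gives (v · Mv)(w · Mw) - (v · Mw)² = 4(νξ)². This `t` is the
  -- value that makes v · Mv = 2νξ.
  set t : ℝ := √(2 * ν * ξ) / (ν + ξ) with ht
  have ht2 : t ^ 2 * (ν + ξ) ^ 2 = 2 * ν * ξ := by
    rw [ht, div_pow, Real.sq_sqrt (by positivity), div_mul_cancel₀ _ (by positivity)]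
  have ht0 : 0 ≤ t := by positivity
  have ht1 : t ≤ 1 := by
    rw [ht, div_le_one (by positivity), Real.sqrt_le_left (by positivity)]
    nlinarith [sq_nonneg ν, sq_nonneg ξ]
  obtain ⟨G, hG, hGdet, h1, h2⟩ := hH.exists_twin_laminate hF hpos (v := ![0, 1, 1])
    (by simp) hRv (t := t) (by linarith) ht1
  obtain ⟨G', hG', hGdet', h1', h2'⟩ := hH.exists_twin_laminate hG (hGdet ▸ hpos)
    (v := ![0, 1, -1]) (by simp) hRw (t := 0) (by norm_num) (by norm_num)
  have hM : (Gᵀ * G).det = (μ * ν * ξ) ^ 2 := by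
    rw [det_mul, det_transpose, hGdet, hdetF, sq]
  have hM' : (G'ᵀ * G').det = (μ * ν * ξ) ^ 2 := by
    rw [det_mul, det_transpose, hGdet', hGdet, hdetF, sq]
  have hpos' : 0 < G'.det := by rw [hGdet', hGdet]; exact hpos
  have hs := hsymm G
  have hs' := hsymm G'
  rw [hFF] at h1 h2
  -- From here only the entries of the two Cauchy–Green tensors matter; testing on e₀, `v` and `w`
  -- determines them together with the determinants.
  generalize hMdef : Gᵀ * G = M at *
  generalize hMdef' : G'ᵀ * G' = M' at *
  have a1 := h1 ![1, 0, 0] ![1, 0, 0] (by simp) (by simp)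
  have a2 := h1 ![1, 0, 0] ![0, 1, -1] (by simp) (by simp)
  have a3 := h1 ![0, 1, -1] ![0, 1, -1] (by simp) (by simp)
  have a4 := h2 ![1, 0, 0] (by simp)
  have a5 := h2 ![0, 1, -1] (by simp)
  have b1 := h1' ![1, 0, 0] ![1, 0, 0] (by simp) (by simp)
  have b2 := h1' ![1, 0, 0] ![0, 1, 1] (by simp) (by simp)
  have b3 := h1' ![0, 1, 1] ![0, 1, 1] (by simp) (by simp)
  have b4 := h2' ![1, 0, 0] (by simp)
  have b5 := h2' ![0, 1, 1] (by simp)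
  simp only [dotProduct, mulVec, Fin.sum_univ_three, diagonal_apply] at a1 a2 a3 a4 a5 b1 b2 b3 b4 b5
  simp [hs 1 0, hs 2 0, hs 2 1, hs' 1 0, hs' 2 0, hs' 2 1] at a1 a2 a3 a4 a5 b1 b2 b3 b4 b5
  rw [det_fin_three] at hM hM'
  rw [hs 1 0, hs 2 0, hs 2 1] at hM
  rw [hs' 1 0, hs' 2 0, hs' 2 1] at hM'
  have z1 : M 0 1 = 0 := by linarith
  have z2 : M 0 2 = 0 := by linarith
  have w1 : M' 0 1 = 0 := by linarith
  have w2 : M' 0 2 = 0 := by linarith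
  have hμ2 : μ ^ 2 ≠ 0 := by positivity
  have hD : M 1 1 * M 2 2 - M 1 2 ^ 2 = (ν * ξ) ^ 2 := by
    rw [z1, z2, a1] at hM
    refine mul_left_cancel₀ hμ2 ?_
    linear_combination hM
  have hX : M 1 1 + M 2 2 + 2 * M 1 2 = 2 * (ν * ξ) := by
    refine mul_right_cancel₀ (b := ν ^ 2 + ξ ^ 2) (by positivity) ?_
    have hB : (M 1 1 - M 2 2) ^ 2 = 2 * ν * ξ * (ν - ξ) ^ 2 := by
      rw [show M 1 1 - M 2 2 = t * (ν ^ 2 - ξ ^ 2) by linarith]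
      linear_combination (ν - ξ) ^ 2 * ht2
    linear_combination (-(M 1 1 + M 2 2 + 2 * M 1 2)) * a3 + 4 * hD + hB
  have hD' : M' 1 1 * M' 2 2 - M' 1 2 ^ 2 = (ν * ξ) ^ 2 := by
    rw [w1, w2, b1, a1] at hM'
    refine mul_left_cancel₀ hμ2 ?_
    linear_combination hM'
  have hp : M' 2 2 = M' 1 1 := by linarith
  have hsum : M' 1 1 + M' 1 2 = ν * ξ := by linarith
  -- The second lamination, with normal `w` and t = 0, keeps v · M'v = 2νξ and sets v · M'w = 0; the
  -- determinant then forces w · M'w = 2νξ, so the block is νξ times the identity.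
  have hdiff : M' 1 1 - M' 1 2 = ν * ξ := by
    refine mul_right_cancel₀ (b := ν * ξ) (by positivity) ?_
    rw [hp] at hD'
    linear_combination hD' - (M' 1 1 - M' 1 2) * hsum
  have w3 : M' 1 2 = 0 := by linarith
  have w4 : M' 1 1 = ν * ξ := by linarith
  have hsq : √(ν * ξ) ^ 2 = ν * ξ := Real.sq_sqrt (by positivity)
  refine hH.diagonal_mem hG' hpos' ?_ ?_
  · intro i
    obtain rfl | rfl | rfl := fin_three_cases i
    · exact hμ
    all_goals exact Real.sqrt_pos.2 (mul_pos hν hξ)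
  · rw [hMdef']
    ext a b
    obtain rfl | rfl | rfl := fin_three_cases a <;> obtain rfl | rfl | rfl := fin_three_cases b <;>
      simp [hs' 1 0, hs' 2 0, hs' 2 1, w1, w2, w3, w4, hp, b1, a1, hsq]

end IsSymmetricLaminationClosed

end ThreeWells

end CubicAustenite

theorem lemma3p5 (Ω : Set CubicAustenite.E3) (hΩ : CubicAustenite.IsBoundedDomain Ω)
    (U : CubicAustenite.Mat3) (hU : U.PosDef) (Δ : ℝ) (hΔ : U.det = Δ)
    (j k : Fin 3) (hjk : j ≠ k) (σ : Equiv.Perm (Fin 3)) (μ ν ξ : ℝ)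
    (hμ : μ = CubicAustenite.stretches U Δ j k (σ 0))
    (hν : ν = CubicAustenite.stretches U Δ j k (σ 1))
    (hξ : ξ = CubicAustenite.stretches U Δ j k (σ 2)) :
    CubicAustenite.threeWells μ (√(ν * ξ)) ⊆
      CubicAustenite.quasiconvexHull Ω (CubicAustenite.wells U) := by
  open CubicAustenite in
  subst hΔ
  have hH := isSymmetricLaminationClosed_wells U
  have hUH : U ∈ {F | LaminationHull (wells U) F} :=
    .base ⟨1, one_mem_P24, 1, one_mem_SO3, by simp⟩
  obtain ⟨hpos, π, hπ⟩ := hH.exists_perm_diagonal_stretches_mem hU hUH hjk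
  -- Composing with the inverse of `π` undoes the unspecified ordering of the stretches and installs
  -- the prescribed one.
  have hσ := hH.diagonal_comp_perm_mem (σ.trans π.symm) hπ
  have hd : (stretches U U.det j k ∘ π) ∘ (σ.trans π.symm) = ![μ, ν, ξ] := by
    ext i
    fin_cases i <;> simp [hμ, hν, hξ]
  rw [hd] at hσ
  have h0 := hH.diagonal_sqrt_mem (hμ ▸ hpos _) (hν ▸ hpos _) (hξ ▸ hpos _) hσ
  have h1 := hH.diagonal_comp_perm_mem (Equiv.swap 0 1) h0
  have h2 := hH.diagonal_comp_perm_mem (Equiv.swap 0 2) h0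
  generalize √(ν * ξ) = s at *
  have e1 : ![μ, s, s] ∘ Equiv.swap 0 1 = ![s, μ, s] := by
    ext i; fin_cases i <;> simp [Equiv.swap_apply_def]
  have e2 : ![μ, s, s] ∘ Equiv.swap 0 2 = ![s, s, μ] := by
    ext i; fin_cases i <;> simp [Equiv.swap_apply_def]
  rw [e1] at h1
  rw [e2] at h2
  rintro _ ⟨Q, hQ, rfl | rfl | rfl⟩
  · exact LaminationHull.mem_quasiconvexHull hΩ (hH.mul_left hQ h0)
  · exact LaminationHull.mem_quasiconvexHull hΩ (hH.mul_left hQ h1)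
  · exact LaminationHull.mem_quasiconvexHull hΩ (hH.mul_left hQ h2)
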